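/- **Theorem (strong duality and subgradients of the value function).** Let $\rho:\mathbb R^m\to(-\infty,+\infty]$ and $\varphi:\mathbb R^n\to(-\infty,+\infty]$ be closed, proper, convex functions (closed convex epigraph, not identically $+\infty$), and let $A\in\mathbb R^{m\times n}$. For a function $h$ write $\operatorname{dom}h=\{h<+\infty\}$, $\operatorname{epi}h=\{(x,t)\in\mathbb R^n\times\mathbb R: h(x)\le t\}$, $\operatorname{lev}_\tau h=\{h\le\tau\}$, $h^*(y)=\sup_x[\langle y,x\rangle-h(x)]$, $h^\infty(z)=\sup_{x\in\operatorname{dom}h}[h(x+z)-h(x)]$, and let $h^\pi(z,\lambda)$ be $\lambda h(\lambda^{-1}z)$ if $\lambda>0$, $h^\infty(z)$ if $\lambda=0$, and $+\infty$ if $\lambda<0$. Let $$f(x,b,\tau)=\rho(b-Ax)+\delta_{\operatorname{epi}\varphi}(x,\tau),\qquad v(b,\tau)=\inf_x f(x,b,\tau),$$ where $\delta_X$ is $0$ on $X$ and $+\infty$ off $X$, and let $$\hat v(b,\tau)=\sup_{(u,\mu)\in\mathbb R^m\times\mathbb R}\big[\langle b,u\rangle+\tau\mu-f^*(0,u,\mu)\big],\qquad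 p_\tau(s,\mu)=\tau\mu+(\varphi^*)^\pi(s,\mu).$$ The subdifferential $\partial v(b,\tau)$ is the set of all $(u,\mu)\in\mathbb R^m\times\mathbb R$ with $v(b',\tau')\ge v(b,\tau)+\langle u,b'-b\rangle+\mu(\tau'-\tau)$ for all $(b',\tau')$, and $\arg\max_S F$ is the set of all $z\in S$ with $F(w)\le F(z)$ for every $w\in S$. Then for all $(b,\tau)\in\mathbb R^m\times\mathbb R$: 1. (Weak duality) $v(b,\tau)\ge\hat v(b,\tau)$. 2. If $(b,\tau)\in\operatorname{int}(\operatorname{dom}v)$, then $v(b,\tau)=\hat v(b,\tau)$ (strong duality), $\partial v(b,\tau)\neq\emptyset$, and $$\partial v(b,\tau)=\arg\max_{u,\mu}\big[\langle b,u\rangle+\tau\mu-f^*(0,u,\mu)\big]=\arg\max_{u,\mu}\big[\langle b,u\rangle-\rho^*(u)-p_\tau(A^Tu,-\mu)\big],$$ where $(u,\mu)$ ranges over $\mathbb R^m\times\mathbb R$. If moreover $v(b,\tau)>-\infty$, then the last maximum may be restricted to $\mu\le0$, i.e. $\partial v(b,\tau)=\arg\max_{u,\,\mu\le0}[\langle b,u\rangle-\rho^*(u)-p_\tau(A^Tu,-\mu)]$.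 3. $\operatorname{dom}f(\cdot,b,\tau)\neq\emptyset$ if and only if $b\in\operatorname{dom}\rho+A(\operatorname{lev}_\tau\varphi)$. 4. $(b,\tau)\in\operatorname{int}(\operatorname{dom}v)$ if and only if $\inf\varphi<\tau$ and $b\in\operatorname{int}\big(\operatorname{dom}\rho+A(\operatorname{lev}_\tau\varphi)\big)$. In particular, for $\tau>\inf\varphi$, $(b,\tau)\in\operatorname{int}(\operatorname{dom}v)$ if and only if $b\in\operatorname{int}\big(\operatorname{dom}\rho+A(\operatorname{lev}_\tau\varphi)\big)$. -/

import Mathlib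

open scoped Pointwise

noncomputable section

namespace ConvexValue

/-! Extended-real-valued functions `h : E → EReal` on a finite-dimensional real space. -/

/-- The effective domain `{x | h x < +∞}`. -/
def dom {E : Type*} (h : E → EReal) : Set E := {x | h x < ⊤}

/-- The epigraph `{(x, t) | h x ≤ t}`. -/
def epi {E : Type*} (h : E → EReal) : Set (E × ℝ) := {p | h p.1 ≤ (p.2 : EReal)}

/-- The lower level set `{x | h x ≤ t}`. -/
def lev {E : Type*} (h : E → EReal) (t : ℝ) : Set E := {x | h x ≤ (t : EReal)}

/-- The function takes values in `(-∞, +∞]`, is finite somewhere, and its epigraph is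
closed and convex. -/
structure ClosedProperConvex {E : Type*} [NormedAddCommGroup E] [NormedSpace ℝ E]
    (h : E → EReal) : Prop where
  ne_bot : ∀ x, h x ≠ ⊥
  dom_nonempty : (dom h).Nonempty
  isClosed_epi : IsClosed (epi h)
  convex_epi : Convex ℝ (epi h)

open Classical in
/-- The indicator of a set: `0` on the set and `+∞` off it. -/
def indic {E : Type*} (X : Set E) (x : E) : EReal := if x ∈ X then 0 else ⊤

/-- The Legendre-Fenchel conjugate `h*(y) = sup_x [⟨y, x⟩ - h x]`. -/
def conj {E : Type*} [NormedAddCommGroup E] [InnerProductSpace ℝ E]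
    (h : E → EReal) (y : E) : EReal :=
  ⨆ x : E, ((inner ℝ y x : ℝ) : EReal) - h x

/-- The horizon function `h^∞(z) = sup_{x ∈ dom h} [h (x + z) - h x]`. -/
def horizon {E : Type*} [AddCommGroup E] (h : E → EReal) (z : E) : EReal :=
  ⨆ x ∈ dom h, h (x + z) - h x

/-- The closure `h^π(z, t)` of the perspective function: `t * h (t⁻¹ z)` for `t > 0`,
`h^∞(z)` for `t = 0` and `+∞` for `t < 0`. -/
def perspective {E : Type*} [AddCommGroup E] [Module ℝ E]
    (h : E → EReal) (z : E) (t : ℝ) : EReal :=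
  if 0 < t then (t : EReal) * h (t⁻¹ • z) else if t = 0 then horizon h z else ⊤

/-- The subdifferential of `w` at `(b, τ)`: all `(u, μ)` such that
`w (b', τ') ≥ w (b, τ) + ⟨u, b' - b⟩ + μ (τ' - τ)` for all `(b', τ')`. -/
def subdiff {E : Type*} [NormedAddCommGroup E] [InnerProductSpace ℝ E]
    (w : E × ℝ → EReal) (q : E × ℝ) : Set (E × ℝ) :=
  {p | ∀ q' : E × ℝ,
    w q + ((inner ℝ p.1 (q'.1 - q.1) + p.2 * (q'.2 - q.2) : ℝ) : EReal) ≤ w q'}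

/-- The set of all maximizers of `F` over the set `S`. -/
def argmaxOn {X : Type*} (S : Set X) (F : X → EReal) : Set X :=
  {z | z ∈ S ∧ ∀ w ∈ S, F w ≤ F z}

section Problem

variable {m n : ℕ} (ρ : EuclideanSpace ℝ (Fin m) → EReal)
  (φ : EuclideanSpace ℝ (Fin n) → EReal) (A : Matrix (Fin m) (Fin n) ℝ)

/-- The perturbation function `f(x, b, τ) = ρ(b - A x) + indic_{epi φ}(x, τ)`. -/
def pert (x : EuclideanSpace ℝ (Fin n)) (b : EuclideanSpace ℝ (Fin m)) (τ : ℝ) : EReal :=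
  ρ (b - A.toEuclideanLin x) + indic (epi φ) (x, τ)

/-- The primal value function `v(b, τ) = inf_x f(x, b, τ)`. -/
def value (q : EuclideanSpace ℝ (Fin m) × ℝ) : EReal :=
  ⨅ x : EuclideanSpace ℝ (Fin n), pert ρ φ A x q.1 q.2

/-- The conjugate of the perturbation function,
`f*(y, u, μ) = sup_{x, b, τ} [⟨y, x⟩ + ⟨u, b⟩ + μ τ - f(x, b, τ)]`. -/
def pertConj (y : EuclideanSpace ℝ (Fin n)) (u : EuclideanSpace ℝ (Fin m)) (μ : ℝ) : EReal :=
  ⨆ (x : EuclideanSpace ℝ (Fin n)) (b : EuclideanSpace ℝ (Fin m)) (τ : ℝ),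
    ((inner ℝ y x + inner ℝ u b + μ * τ : ℝ) : EReal) - pert ρ φ A x b τ

/-- The objective `⟨b, u⟩ + τ μ - f*(0, u, μ)` of the dual problem at `q = (b, τ)`. -/
def dualObj (q p : EuclideanSpace ℝ (Fin m) × ℝ) : EReal :=
  ((inner ℝ q.1 p.1 + q.2 * p.2 : ℝ) : EReal) - pertConj ρ φ A 0 p.1 p.2

/-- The dual value function
`v̂(b, τ) = sup_{u, μ} [⟨b, u⟩ + τ μ - f*(0, u, μ)]`. -/
def dualValue (q : EuclideanSpace ℝ (Fin m) × ℝ) : EReal :=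
  ⨆ p : EuclideanSpace ℝ (Fin m) × ℝ, dualObj ρ φ A q p

/-- `p_τ(s, μ) = τ μ + (φ*)^π(s, μ)`. -/
def pFun (τ : ℝ) (s : EuclideanSpace ℝ (Fin n)) (μ : ℝ) : EReal :=
  ((τ * μ : ℝ) : EReal) + perspective (conj φ) s μ

/-- The explicit dual objective `⟨b, u⟩ - ρ*(u) - p_τ(Aᵀ u, -μ)` at `q = (b, τ)`. -/
def explicitDualObj (q p : EuclideanSpace ℝ (Fin m) × ℝ) : EReal :=
  ((inner ℝ q.1 p.1 : ℝ) : EReal) - conj ρ p.1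
    - pFun φ q.2 (A.transpose.toEuclideanLin p.1) (-p.2)

end Problem

end ConvexValue

end

/-!
The value function `v` is the partial infimum over `x` of a jointly convex function, hence convex.
At an interior point of `dom v` where `v` is finite, a supporting hyperplane of its strict epigraph
is not vertical and gives a subgradient (`exists_subgradient`). A pair `(u, μ)` is a subgradient
of `v` at `(b, τ)` exactly when `v(b, τ) ≤ ⟨b, u⟩ + τ μ - f*(0, u, μ)`
(`mem_subdiff_value_iff`), because `f*(0, ·)` is the conjugate of `v`. With weak duality
(`dualObj_le_value`), the existence of one subgradient yields strong duality and identifies the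
subdifferential with the set of dual maximizers (`strong_duality`).

The explicit form of the dual comes from the substitution `w = b - A x`, which splits `f*(0, u, μ)`
into `ρ*(u)` plus the support function of `epi φ` at `(Aᵀ u, μ)` (`pertConj_zero`). That support
function is the closed perspective of `φ*` at `(Aᵀ u, -μ)` (`epiSupport_eq_perspective`); for
`μ = 0` this says that the support function of `dom φ` is the horizon function of `φ*`. The two
dual objectives therefore agree everywhere, and for `μ > 0` both are `-∞`.

The slice of `dom v` at level `τ` is `dom ρ + A (lev_τ φ)`. As `dom v` is convex and closed under
increasing `τ`, an interior point of a slice is interior to `dom v` as soon as `dom v` reaches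
strictly below that level (`mem_interior_of_mem_interior_slice`).
-/

namespace ConvexValue

/-! ### Extended-real arithmetic and elementary facts on conjugates -/

/-- For real `r` the map `X ↦ r - X` is an antitone involution of the extended reals, including
at the infinite values. -/
theorem coe_sub_le_comm {r : ℝ} {X Y : EReal} : (r : EReal) - X ≤ Y ↔ (r : EReal) - Y ≤ X := by
  induction X <;> induction Y <;>
    simp [← EReal.coe_sub, add_comm]

theorem le_coe_sub_comm {r : ℝ} {X Y : EReal} : X ≤ (r : EReal) - Y ↔ Y ≤ (r : EReal) - X := by
  induction X <;> induction Y <;>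
    simp [← EReal.coe_sub, le_sub_comm]

section Conj

variable {E : Type*} [NormedAddCommGroup E] [InnerProductSpace ℝ E] {h : E → EReal}

theorem conj_ne_bot (hh : (dom h).Nonempty) (y : E) : conj h y ≠ ⊥ := by
  obtain ⟨x, hx⟩ := hh
  have hx' : h x ≠ ⊤ := ne_of_lt hx
  intro hb
  have := (le_iSup (fun x : E => ((inner ℝ y x : ℝ) : EReal) - h x) x).trans_eq hb
  revert this hx'
  induction h x <;> simp [← EReal.coe_sub]

theorem inner_sub_le_conj (y : E) {x : E} {t : ℝ} (hx : h x ≤ t) :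
    ((inner ℝ y x - t : ℝ) : EReal) ≤ conj h y := by
  refine le_trans ?_ (le_iSup (fun x : E => ((inner ℝ y x : ℝ) : EReal) - h x) x)
  rw [EReal.coe_sub]
  exact EReal.sub_le_sub le_rfl hx

/-- A closed proper convex function has an affine minorant: separate the point
`(x₀, h x₀ - 1)` from the epigraph; the separating hyperplane is not vertical because it
also separates it from `(x₀, h x₀)`. -/
theorem dom_conj_nonempty [CompleteSpace E] (hh : ClosedProperConvex h) :
    (dom (conj h)).Nonempty := by
  obtain ⟨x₀, hx₀⟩ := hh.dom_nonempty
  obtain ⟨r, hr⟩ : ∃ r : ℝ, h x₀ = r :=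
    ⟨_, (EReal.coe_toReal (ne_of_lt hx₀) (hh.ne_bot x₀)).symm⟩
  have hnot : (x₀, r - 1) ∉ epi h := by
    simp only [epi, Set.mem_ofPred_eq, hr, EReal.coe_le_coe_iff]; linarith
  obtain ⟨g, u, hgu, hg⟩ := geometric_hahn_banach_point_closed hh.convex_epi hh.isClosed_epi hnot
  have hsplit : ∀ (x : E) (t : ℝ), g (x, t) = g (x, 0) + t * g (0, 1) := by
    intro x t
    have : (x, t) = (x, (0 : ℝ)) + t • ((0 : E), (1 : ℝ)) := by simp
    rw [this, map_add, map_smul, smul_eq_mul]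
  have h1 := hg (x₀, r) (by simp [epi, hr])
  rw [hsplit] at hgu h1
  have hc : 0 < g (0, 1) := by nlinarith
  set c := g (0, 1) with hcdef
  let p : E := (InnerProductSpace.toDual ℝ E).symm (g.comp (ContinuousLinearMap.inl ℝ E ℝ))
  have hp : ∀ x, inner ℝ p x = g (x, 0) := by
    intro x; simp [p]
  refine ⟨(-c⁻¹) • p, lt_of_le_of_lt (iSup_le fun x => ?_) (EReal.coe_lt_top (-(c⁻¹ * u)))⟩
  rw [coe_sub_le_comm]
  induction hx : h x with
  | bot => exact absurd hx (hh.ne_bot x)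
  | top => exact le_top
  | coe t =>
    rw [← EReal.coe_sub, EReal.coe_le_coe_iff, inner_smul_left, hp]
    have h2 := hg (x, t) (by simp [epi, hx])
    rw [hsplit] at h2
    have h3 : c⁻¹ * u ≤ c⁻¹ * (g (x, 0) + t * c) := by gcongr
    have h4 : c⁻¹ * (g (x, 0) + t * c) = c⁻¹ * g (x, 0) + t := by field_simp
    simp only [conj_trivial]
    linarith

/-! ### The support function of an epigraph -/

/-- The support function of the epigraph of `h`,
`(s, μ) ↦ sup {⟨s, x⟩ + μ t | h x ≤ t}`. -/
noncomputable def epiSupport (h : E → EReal) (s : E) (μ : ℝ) : EReal :=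
  ⨆ p ∈ epi h, ((inner ℝ s p.1 + μ * p.2 : ℝ) : EReal)

theorem le_epiSupport (s : E) (μ : ℝ) {x : E} {t : ℝ} (hx : h x ≤ t) :
    ((inner ℝ s x + μ * t : ℝ) : EReal) ≤ epiSupport h s μ :=
  le_iSup₂_of_le (f := fun (p : E × ℝ) (_ : p ∈ epi h) =>
    ((inner ℝ s p.1 + μ * p.2 : ℝ) : EReal)) (x, t) hx le_rfl

theorem epi_nonempty {X : Type*} {h : X → EReal} (hh : (dom h).Nonempty) : (epi h).Nonempty := by
  obtain ⟨x, hx⟩ := hh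
  exact ⟨(x, (h x).toReal), EReal.le_coe_toReal (ne_of_lt hx)⟩

/-- Epigraphs are unbounded upwards, so their support function is `+∞` for positive `μ`. -/
theorem epiSupport_of_pos (hh : (dom h).Nonempty) (s : E) {μ : ℝ} (hμ : 0 < μ) :
    epiSupport h s μ = ⊤ := by
  obtain ⟨⟨x, t⟩, hx⟩ := epi_nonempty hh
  rw [EReal.eq_top_iff_forall_lt]
  intro y
  set t' := max t ((y + 1 - inner ℝ s x) / μ)
  have hx' : h x ≤ (t' : ℝ) :=
    le_trans (show h x ≤ t from hx) (EReal.coe_le_coe_iff.2 (le_max_left _ _))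
  refine lt_of_lt_of_le (EReal.coe_lt_coe_iff.2 ?_) (le_epiSupport s μ hx')
  have h1 : (y + 1 - inner ℝ s x) / μ ≤ t' := le_max_right _ _
  rw [div_le_iff₀ hμ] at h1
  linarith

theorem epiSupport_neg_of_pos (hh : ∀ x, h x ≠ ⊥) (s : E) {t : ℝ} (ht : 0 < t) :
    epiSupport h s (-t) = (t : EReal) * conj h (t⁻¹ • s) := by
  have ht' : (0 : EReal) < t := by exact_mod_cast ht
  apply le_antisymm
  · refine iSup₂_le fun ⟨x, a⟩ hx => ?_
    have h1 := inner_sub_le_conj (t⁻¹ • s) (show h x ≤ a from hx)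
    have h2 := mul_le_mul_of_nonneg_left h1 ht'.le
    rw [← EReal.coe_mul, inner_smul_left] at h2
    convert h2 using 2
    simp only [conj_trivial]
    field_simp
    ring
  · rw [mul_comm, ← EReal.le_div_iff_mul_le ht' (EReal.coe_ne_top t)]
    refine iSup_le fun x => ?_
    rw [EReal.le_div_iff_mul_le ht' (EReal.coe_ne_top t)]
    induction hx : h x with
    | bot => exact absurd hx (hh x)
    | top => simp [EReal.bot_mul_coe_of_pos ht]
    | coe a =>
      rw [← EReal.coe_sub, ← EReal.coe_mul, inner_smul_left]
      convert le_epiSupport s (-t) hx.le using 2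
      simp only [conj_trivial]
      field_simp
      ring

/-- The support function of `dom h` is the horizon function of the conjugate. If
`h*^∞(s) ≤ c`, iterating gives `h*(y₀ + k s) ≤ h*(y₀) + k c` for all `k`, and the
Fenchel-Young inequality at `x ∈ dom h` then bounds `k (⟨s, x⟩ - c)` independently of `k`. -/
theorem epiSupport_zero (hh : ∀ x, h x ≠ ⊥) (hd : (dom h).Nonempty)
    (hc : (dom (conj h)).Nonempty) (s : E) :
    epiSupport h s 0 = horizon (conj h) s := by
  apply le_antisymm
  · refine iSup₂_le fun ⟨x, t⟩ hx => ?_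
    by_contra! hlt
    obtain ⟨c, hc1, hc2⟩ := EReal.lt_iff_exists_real_btwn.1 hlt
    obtain ⟨y₀, hy₀⟩ := hc
    obtain ⟨a, ha⟩ : ∃ a : ℝ, conj h y₀ = a :=
      ⟨_, (EReal.coe_toReal (ne_of_lt hy₀) (conj_ne_bot hd y₀)).symm⟩
    have key : ∀ k : ℕ, conj h (y₀ + (k : ℝ) • s) ≤ ((a + k * c : ℝ) : EReal) := by
      intro k
      induction k with
      | zero => simp [ha]
      | succ k ih =>
        have hdom : y₀ + (k : ℝ) • s ∈ dom (conj h) := lt_of_le_of_lt ih (EReal.coe_lt_top _)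
        have h1 : conj h (y₀ + (k : ℝ) • s + s) - conj h (y₀ + (k : ℝ) • s) ≤ c :=
          le_trans (le_iSup₂ (f := fun (y : E) (_ : y ∈ dom (conj h)) =>
            conj h (y + s) - conj h y) _ hdom) hc1.le
        rw [EReal.sub_le_iff_le_add (Or.inl (conj_ne_bot hd _)) (Or.inl (ne_of_lt hdom))] at h1
        have h2 : y₀ + ((k + 1 : ℕ) : ℝ) • s = y₀ + (k : ℝ) • s + s := by
          push_cast; rw [add_smul, one_smul, add_assoc]
        rw [h2]
        refine h1.trans ((add_le_add le_rfl ih).trans_eq ?_)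
        rw [← EReal.coe_add]
        congr 1
        push_cast
        ring
    have hlt' : c < inner ℝ s x := by
      have := EReal.coe_lt_coe_iff.1 hc2
      simpa using this
    obtain ⟨k, hk⟩ := exists_nat_gt ((a + t - inner ℝ y₀ x) / (inner ℝ s x - c))
    rw [div_lt_iff₀ (by linarith)] at hk
    have h3 := EReal.coe_le_coe_iff.1
      ((inner_sub_le_conj (y₀ + (k : ℝ) • s) (show h x ≤ t from hx)).trans (key k))
    rw [inner_add_left, inner_smul_left] at h3
    simp only [conj_trivial] at h3
    nlinarith
  · refine iSup₂_le fun y hy => ?_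
    rw [EReal.sub_le_iff_le_add (Or.inl (conj_ne_bot hd _)) (Or.inl (ne_of_lt hy))]
    refine iSup_le fun x => ?_
    induction hx : h x with
    | bot => exact absurd hx (hh x)
    | top => simp
    | coe t =>
      have h1 := add_le_add (le_epiSupport s 0 hx.le) (inner_sub_le_conj y hx.le)
      rw [← EReal.coe_add] at h1
      rw [← EReal.coe_sub, inner_add_left]
      convert h1 using 2
      ring

/-- The support function of the epigraph of `h` is the closed perspective of the conjugate. -/
theorem epiSupport_eq_perspective [CompleteSpace E] (hh : ClosedProperConvex h) (s : E) (μ : ℝ) :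
    epiSupport h s μ = perspective (conj h) s (-μ) := by
  unfold perspective
  rcases lt_trichotomy μ 0 with hμ | rfl | hμ
  · rw [if_pos (by linarith), ← epiSupport_neg_of_pos hh.ne_bot s (neg_pos.2 hμ), neg_neg]
  · simp [epiSupport_zero hh.ne_bot hh.dom_nonempty (dom_conj_nonempty hh)]
  · rw [if_neg (by linarith), if_neg (by linarith), epiSupport_of_pos hh.dom_nonempty s hμ]

theorem epiSupport_ne_bot (hd : (dom h).Nonempty) (s : E) (μ : ℝ) :
    epiSupport h s μ ≠ ⊥ := by
  obtain ⟨⟨x, t⟩, hx⟩ := epi_nonempty hd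
  exact ne_bot_of_le_ne_bot (EReal.coe_ne_bot _) (le_epiSupport s μ hx)

end Conj

/-! ### Subgradients of convex extended-real functions -/

/-- A convex function on a finite-dimensional space, given by the convexity of its strict
epigraph, has a subgradient at every interior point of its domain where it is finite. A simplex
around the point bounds the function above near it, so the strict epigraph has interior points
above it; hence a hyperplane supporting the strict epigraph there is not vertical. -/
theorem exists_subgradient {F : Type*} [NormedAddCommGroup F] [NormedSpace ℝ F]
    [FiniteDimensional ℝ F] {w : F → EReal}
    (hw : Convex ℝ {z : F × ℝ | w z.1 < z.2}) {q : F} (hq : q ∈ interior (dom w)) {a : ℝ}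
    (ha : w q = a) : ∃ p : F →L[ℝ] ℝ, ∀ q', ((a + p (q' - q) : ℝ) : EReal) ≤ w q' := by
  set C := {z : F × ℝ | w z.1 < z.2} with hC
  obtain ⟨β, hβ1, hβ2⟩ := exists_mem_interior_convexHull_affineBasis (mem_interior_iff_mem_nhds.1 hq)
  have hub : ∃ M : ℝ, ∀ i, w (β i) < M := by
    have h1 : ∀ i, ∃ M : ℝ, w (β i) < M := fun i =>
      (EReal.lt_iff_exists_real_btwn.1
        (show w (β i) < ⊤ from hβ2 (subset_convexHull ℝ _ ⟨i, rfl⟩))).imp fun _ h => h.1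
    choose M hM using h1
    obtain ⟨B, hB⟩ := (Set.finite_range M).bddAbove
    exact ⟨B, fun i => (hM i).trans_le (EReal.coe_le_coe_iff.2 (hB ⟨i, rfl⟩))⟩
  obtain ⟨M, hM⟩ := hub
  have hslice : ∀ t : ℝ, M ≤ t → convexHull ℝ (Set.range β) ⊆ {x | (x, t) ∈ C} := by
    intro t ht
    refine convexHull_min ?_ ?_
    · rintro _ ⟨i, rfl⟩
      exact (hM i).trans_le (EReal.coe_le_coe_iff.2 ht)
    · intro x hx y hy c d hc hd hcd
      have := hw hx hy hc hd hcd
      simpa [← add_mul, hcd] using this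
  have hint : ∀ t : ℝ, M < t → (q, t) ∈ interior C := by
    intro t ht
    refine mem_interior.2 ⟨interior (convexHull ℝ (Set.range β)) ×ˢ Set.Ioi M, ?_,
      isOpen_interior.prod isOpen_Ioi, hβ1, ht⟩
    rintro ⟨x, s⟩ ⟨hx, hs⟩
    exact hslice s (le_of_lt hs) (interior_subset hx)
  have hnot : (q, a) ∉ interior C := fun h => by
    have h' : (q, a) ∈ C := interior_subset h
    exact absurd ha (ne_of_lt h')
  obtain ⟨g, hg⟩ := geometric_hahn_banach_open_point hw.interior isOpen_interior hnot
  have hsplit : ∀ (x : F) (t : ℝ), g (x, t) = g (x, 0) + t * g (0, 1) := by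
    intro x t
    have : (x, t) = (x, (0 : ℝ)) + t • ((0 : F), (1 : ℝ)) := by simp
    rw [this, map_add, map_smul, smul_eq_mul]
  have hc : g (0, 1) < 0 := by
    have h1 := hg _ (hint (max M a + 1) (by linarith [le_max_left M a]))
    rw [hsplit q, hsplit q a] at h1
    have h2 := le_max_right M a
    nlinarith
  have hle : ∀ z ∈ C, g z ≤ g (q, a) := by
    intro z hz
    have hz' : z ∈ closure (interior C) := by
      rw [hw.closure_interior_eq_closure_of_nonempty_interior ⟨_, hint (M + 1) (by linarith)⟩]
      exact subset_closure hz
    exact closure_minimal (fun y hy => (hg y hy).le) (isClosed_le g.continuous continuous_const) hz'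
  set c := g (0, 1) with hcdef
  refine ⟨(-c⁻¹) • g.comp (ContinuousLinearMap.inl ℝ F ℝ), fun q' => ?_⟩
  refine EReal.le_of_forall_lt_iff_le.1 fun t ht => ?_
  rw [EReal.coe_le_coe_iff]
  have h1 := hle (q', t) ht
  rw [hsplit, hsplit q a] at h1
  have h2 : g (q' - q, 0) = g (q', 0) - g (q, 0) := by rw [← map_sub]; simp
  have h3 : ((-c⁻¹) • g.comp (ContinuousLinearMap.inl ℝ F ℝ)) (q' - q)
      = (-c⁻¹) * g (q' - q, 0) := by simp
  rw [h3, h2]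
  have h4 : 0 < -c⁻¹ := by rw [neg_pos]; exact inv_lt_zero.2 hc
  have h5 : (-c⁻¹) * (g (q', 0) - g (q, 0)) ≤ (-c⁻¹) * ((a - t) * c) :=
    mul_le_mul_of_nonneg_left (by linarith) h4.le
  have h6 : (-c⁻¹) * ((a - t) * c) = t - a := by field_simp [hc.ne]; ring
  linarith

section Problem

variable {m n : ℕ} {ρ : EuclideanSpace ℝ (Fin m) → EReal}
  {φ : EuclideanSpace ℝ (Fin n) → EReal} {A : Matrix (Fin m) (Fin n) ℝ}

/-! ### The conjugate of the perturbation function and the dual objective -/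

theorem pert_of_le {x : EuclideanSpace ℝ (Fin n)} {τ : ℝ} (hx : φ x ≤ τ)
    (b : EuclideanSpace ℝ (Fin m)) : pert ρ φ A x b τ = ρ (b - A.toEuclideanLin x) := by
  have : (x, τ) ∈ epi φ := hx
  simp [pert, indic, this]

theorem pert_of_not_le (hρ : ∀ w, ρ w ≠ ⊥) {x : EuclideanSpace ℝ (Fin n)} {τ : ℝ}
    (hx : ¬ φ x ≤ τ) (b : EuclideanSpace ℝ (Fin m)) : pert ρ φ A x b τ = ⊤ := by
  have : (x, τ) ∉ epi φ := hx
  simp [pert, indic, this, EReal.add_top_of_ne_bot (hρ _)]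

theorem pert_lt_iff (hρ : ∀ w, ρ w ≠ ⊥) {x : EuclideanSpace ℝ (Fin n)}
    {b : EuclideanSpace ℝ (Fin m)} {τ : ℝ} {c : EReal} :
    pert ρ φ A x b τ < c ↔ ρ (b - A.toEuclideanLin x) < c ∧ φ x ≤ τ := by
  by_cases hx : φ x ≤ τ
  · simp [pert_of_le hx, hx]
  · simp [pert_of_not_le hρ hx, hx]

theorem inner_transpose_toEuclideanLin (A : Matrix (Fin m) (Fin n) ℝ)
    (u : EuclideanSpace ℝ (Fin m)) (x : EuclideanSpace ℝ (Fin n)) :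
    inner ℝ (A.transpose.toEuclideanLin u) x = inner ℝ u (A.toEuclideanLin x) := by
  rw [← Matrix.conjTranspose_eq_transpose_of_trivial,
    Matrix.toEuclideanLin_conjTranspose_eq_adjoint, LinearMap.adjoint_inner_left]

/-- Substituting `w = b - A x` decouples the supremum defining `f*(0, u, μ)`. -/
theorem pertConj_zero (hρ : ∀ w, ρ w ≠ ⊥) (u : EuclideanSpace ℝ (Fin m)) (μ : ℝ) :
    pertConj ρ φ A 0 u μ = conj ρ u + epiSupport φ (A.transpose.toEuclideanLin u) μ := by
  apply le_antisymm
  · refine iSup_le fun x => iSup_le fun b => iSup_le fun τ => ?_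
    by_cases hx : φ x ≤ τ
    · rw [pert_of_le hx]
      induction hw : ρ (b - A.toEuclideanLin x) with
      | bot => exact absurd hw (hρ _)
      | top => simp
      | coe r =>
        have h1 := add_le_add (inner_sub_le_conj u hw.le)
          (le_epiSupport (A.transpose.toEuclideanLin u) μ hx)
        rw [← EReal.coe_add, inner_transpose_toEuclideanLin, inner_sub_right] at h1
        rw [← EReal.coe_sub, inner_zero_left]
        convert h1 using 2
        ring
    · rw [pert_of_not_le hρ hx, EReal.sub_top]
      exact bot_le
  · refine EReal.add_le_of_forall_lt fun a' ha b' hb => ?_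
    obtain ⟨w, hw⟩ := lt_iSup_iff.1 ha
    obtain ⟨⟨x, τ⟩, hb⟩ := lt_iSup_iff.1 hb
    obtain ⟨hx, hb⟩ := lt_iSup_iff.1 hb
    refine (add_le_add hw.le hb.le).trans ?_
    refine le_trans ?_ (le_iSup_of_le x (le_iSup_of_le (w + A.toEuclideanLin x)
      (le_iSup_of_le τ le_rfl)))
    rw [pert_of_le hx, add_sub_cancel_right]
    induction hw : ρ w with
    | bot => exact absurd hw (hρ _)
    | top => simp
    | coe r =>
      rw [← EReal.coe_sub, ← EReal.coe_sub, ← EReal.coe_add, inner_transpose_toEuclideanLin,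
        inner_add_right, inner_zero_left]
      exact EReal.coe_le_coe_iff.2 (le_of_eq (by ring))

theorem explicitDualObj_eq_dualObj (hρ : ClosedProperConvex ρ) (hφ : ClosedProperConvex φ)
    (q : EuclideanSpace ℝ (Fin m) × ℝ) :
    explicitDualObj ρ φ A q = dualObj ρ φ A q := by
  funext ⟨u, μ⟩
  simp only [explicitDualObj, dualObj, pFun, pertConj_zero hρ.ne_bot]
  rw [← epiSupport_eq_perspective hφ]
  have h1 := conj_ne_bot hρ.dom_nonempty u
  have h2 := epiSupport_ne_bot hφ.dom_nonempty (A.transpose.toEuclideanLin u) μ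
  -- Both `ρ*(u)` and the support function exceed `-∞`, so no `∞ - ∞` arises.
  generalize conj ρ u = X at h1 ⊢
  generalize epiSupport φ (A.transpose.toEuclideanLin u) μ = Y at h2 ⊢
  induction X with
  | bot => exact absurd rfl h1
  | top => rw [EReal.top_add_of_ne_bot h2, EReal.sub_top, EReal.sub_top, EReal.bot_sub]
  | coe x =>
    induction Y with
    | bot => exact absurd rfl h2
    | top => rw [EReal.coe_add_top, EReal.coe_add_top, EReal.sub_top, EReal.sub_top]
    | coe y =>
      simp only [← EReal.coe_sub, ← EReal.coe_add]
      congr 1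
      ring

theorem dualObj_of_pos (hρ : ClosedProperConvex ρ) (hφ : ClosedProperConvex φ)
    (q : EuclideanSpace ℝ (Fin m) × ℝ) (u : EuclideanSpace ℝ (Fin m)) {μ : ℝ} (hμ : 0 < μ) :
    dualObj ρ φ A q (u, μ) = ⊥ := by
  simp only [dualObj, pertConj_zero hρ.ne_bot]
  rw [epiSupport_of_pos hφ.dom_nonempty _ hμ,
    EReal.add_top_of_ne_bot (conj_ne_bot hρ.dom_nonempty u), EReal.sub_top]

/-! ### Duality -/

theorem dualObj_le_value (q p : EuclideanSpace ℝ (Fin m) × ℝ) :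
    dualObj ρ φ A q p ≤ value ρ φ A q := by
  refine le_iInf fun x => ?_
  rw [dualObj, coe_sub_le_comm]
  refine le_trans (le_of_eq ?_) (le_iSup_of_le x (le_iSup_of_le q.1 (le_iSup_of_le q.2 le_rfl)))
  rw [inner_zero_left, zero_add, real_inner_comm, mul_comm]

/-- Where the value function is finite, a subgradient is a dual point whose objective is at
least (hence equal to) the value: this is the equality case of the Fenchel-Young inequality
for `v`, whose conjugate is `f*(0, ·)`. -/
theorem mem_subdiff_value_iff {q : EuclideanSpace ℝ (Fin m) × ℝ} {a : ℝ}
    (ha : value ρ φ A q = a) (p : EuclideanSpace ℝ (Fin m) × ℝ) :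
    p ∈ subdiff (value ρ φ A) q ↔ value ρ φ A q ≤ dualObj ρ φ A q p := by
  rw [dualObj, le_coe_sub_comm, ha, ← EReal.coe_sub]
  have hsub : p ∈ subdiff (value ρ φ A) q ↔ ∀ q' : EuclideanSpace ℝ (Fin m) × ℝ, ∀ x,
      (a : EReal) + ((inner ℝ p.1 (q'.1 - q.1) + p.2 * (q'.2 - q.2) : ℝ) : EReal)
        ≤ pert ρ φ A x q'.1 q'.2 := by
    simp only [subdiff, Set.mem_ofPred_eq, ha]
    simp only [value, le_iInf_iff]
  simp only [hsub, pertConj, iSup_le_iff]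
  have key : ∀ (x : EuclideanSpace ℝ (Fin n)) (b : EuclideanSpace ℝ (Fin m)) (τ : ℝ),
      ((inner ℝ 0 x + inner ℝ p.1 b + p.2 * τ : ℝ) : EReal) - pert ρ φ A x b τ
          ≤ ((inner ℝ q.1 p.1 + q.2 * p.2 - a : ℝ) : EReal)
        ↔ (a : EReal) + ((inner ℝ p.1 (b - q.1) + p.2 * (τ - q.2) : ℝ) : EReal)
          ≤ pert ρ φ A x b τ := by
    intro x b τ
    rw [coe_sub_le_comm, ← EReal.coe_sub, ← EReal.coe_add]
    have : (inner ℝ 0 x + inner ℝ p.1 b + p.2 * τ - (inner ℝ q.1 p.1 + q.2 * p.2 - a) : ℝ)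
        = a + (inner ℝ p.1 (b - q.1) + p.2 * (τ - q.2)) := by
      rw [inner_zero_left, inner_sub_right, real_inner_comm p.1 q.1]
      ring
    rw [this]
  simp only [key]
  exact ⟨fun h x b τ => h (b, τ) x, fun h q' x => h x q'.1 q'.2⟩

/-! ### Convexity and the domain of the value function -/

theorem value_lt_iff (hρ : ∀ w, ρ w ≠ ⊥) {q : EuclideanSpace ℝ (Fin m) × ℝ} {c : EReal} :
    value ρ φ A q < c ↔ ∃ x, ρ (q.1 - A.toEuclideanLin x) < c ∧ φ x ≤ q.2 := by
  simp only [value, iInf_lt_iff, pert_lt_iff hρ]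

theorem _root_.Convex.strictEpigraph {E : Type*} [AddCommGroup E] [Module ℝ E] {h : E → EReal}
    (hh : Convex ℝ (epi h)) : Convex ℝ {z : E × ℝ | h z.1 < z.2} := by
  rintro ⟨x, s⟩ hx ⟨y, t⟩ hy c d hc hd hcd
  obtain ⟨s', hs1, hs2⟩ := EReal.lt_iff_exists_real_btwn.1 hx
  obtain ⟨t', ht1, ht2⟩ := EReal.lt_iff_exists_real_btwn.1 hy
  have h1 : (c • (x, s') + d • (y, t')) ∈ epi h := hh hs1.le ht1.le hc hd hcd
  refine lt_of_le_of_lt h1 (EReal.coe_lt_coe_iff.2 ?_)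
  have hs := EReal.coe_lt_coe_iff.1 hs2
  have ht := EReal.coe_lt_coe_iff.1 ht2
  simp only [Prod.snd_add, Prod.smul_snd, smul_eq_mul]
  rcases hc.eq_or_lt with rfl | hc
  · obtain rfl : d = 1 := by linarith
    simpa using ht
  · have := mul_lt_mul_of_pos_left hs hc
    have := mul_le_mul_of_nonneg_left ht.le hd
    linarith

theorem convex_strictEpigraph_value (hρ : ClosedProperConvex ρ) (hφ : ClosedProperConvex φ) :
    Convex ℝ {z : (EuclideanSpace ℝ (Fin m) × ℝ) × ℝ | value ρ φ A z.1 < z.2} := by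
  rintro ⟨⟨b₁, τ₁⟩, t₁⟩ h₁ ⟨⟨b₂, τ₂⟩, t₂⟩ h₂ c d hc hd hcd
  obtain ⟨x₁, hr₁, hx₁⟩ := (value_lt_iff hρ.ne_bot).1 h₁
  obtain ⟨x₂, hr₂, hx₂⟩ := (value_lt_iff hρ.ne_bot).1 h₂
  refine (value_lt_iff hρ.ne_bot).2 ⟨c • x₁ + d • x₂, ?_, ?_⟩
  · have := hρ.convex_epi.strictEpigraph
      (show (b₁ - A.toEuclideanLin x₁, t₁) ∈ {z : _ × ℝ | ρ z.1 < z.2} from hr₁)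
      (show (b₂ - A.toEuclideanLin x₂, t₂) ∈ {z : _ × ℝ | ρ z.1 < z.2} from hr₂) hc hd hcd
    have heq : (c • b₁ + d • b₂) - A.toEuclideanLin (c • x₁ + d • x₂)
        = c • (b₁ - A.toEuclideanLin x₁) + d • (b₂ - A.toEuclideanLin x₂) := by
      simp only [map_add, map_smul, smul_sub]
      abel
    exact lt_of_eq_of_lt (congrArg ρ heq) this
  · exact hφ.convex_epi (show (x₁, τ₁) ∈ epi φ from hx₁) (show (x₂, τ₂) ∈ epi φ from hx₂) hc hd hcd

theorem convex_dom_of_strictEpigraph {E : Type*} [AddCommGroup E] [Module ℝ E] {w : E → EReal}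
    (hw : Convex ℝ {z : E × ℝ | w z.1 < z.2}) : Convex ℝ (dom w) := by
  intro x hx y hy c d hc hd hcd
  obtain ⟨s, hs, -⟩ := EReal.lt_iff_exists_real_btwn.1 hx
  obtain ⟨t, ht, -⟩ := EReal.lt_iff_exists_real_btwn.1 hy
  have h1 : (c • (x, s) + d • (y, t)) ∈ {z : E × ℝ | w z.1 < z.2} := hw hs ht hc hd hcd
  exact lt_of_lt_of_le (show w (c • x + d • y) < _ from h1) le_top

theorem mem_dom_value_iff (hρ : ∀ w, ρ w ≠ ⊥) {b : EuclideanSpace ℝ (Fin m)} {τ : ℝ} :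
    (b, τ) ∈ dom (value ρ φ A) ↔ b ∈ dom ρ + A.toEuclideanLin '' lev φ τ := by
  simp only [dom, Set.mem_ofPred_eq, value_lt_iff hρ, Set.mem_add, Set.mem_image]
  constructor
  · rintro ⟨x, h1, h2⟩
    exact ⟨_, h1, _, ⟨x, h2, rfl⟩, sub_add_cancel _ _⟩
  · rintro ⟨w, hw, _, ⟨x, hx, rfl⟩, rfl⟩
    exact ⟨x, by simpa using hw, hx⟩

theorem dom_pert_nonempty_iff {b : EuclideanSpace ℝ (Fin m)} {τ : ℝ} :
    (dom fun x => pert ρ φ A x b τ).Nonempty ↔ (b, τ) ∈ dom (value ρ φ A) :=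
  (iInf_lt_iff (f := fun x => pert ρ φ A x b τ)).symm

/-- Let `D ⊆ F × ℝ` be convex and closed under increasing the last coordinate. If `D` has a point
strictly below the level `τ`, then interior points of the slice at level `τ` are interior points
of `D`: a small push of the slice towards the low point still covers a neighbourhood of `b`, now
at a level below `τ`. -/
theorem mem_interior_of_mem_interior_slice {F : Type*} [NormedAddCommGroup F] [NormedSpace ℝ F]
    {D : Set (F × ℝ)} (hD : Convex ℝ D) (hup : ∀ b s t, s ≤ t → (b, s) ∈ D → (b, t) ∈ D)
    {b₀ b : F} {τ₀ τ : ℝ} (h₀ : (b₀, τ₀) ∈ D) (hlt : τ₀ < τ)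
    (hb : b ∈ interior {b' | (b', τ) ∈ D}) : (b, τ) ∈ interior D := by
  have hcont : ContinuousAt (fun z : ℝ × F => (1 - z.1)⁻¹ • (z.2 - z.1 • b₀)) (0, b) := by
    refine ContinuousAt.smul (ContinuousAt.inv₀ (by fun_prop) (by simp)) (by fun_prop)
  have hev := hcont.eventually_mem (isOpen_interior.mem_nhds (by simpa using hb))
  rw [nhds_prod_eq] at hev
  obtain ⟨P, hP, Q, hQ, hPQ⟩ := Filter.eventually_prod_iff.1 hev
  have hP' : ∀ᶠ s in nhdsWithin (0 : ℝ) (Set.Ioi 0), P s ∧ s ∈ Set.Ioo (0 : ℝ) 1 :=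
    (hP.filter_mono nhdsWithin_le_nhds).and (Ioo_mem_nhdsGT one_pos)
  obtain ⟨s, hs, hs0, hs1⟩ := hP'.exists
  have hlev : (1 - s) * τ + s * τ₀ < τ := by nlinarith
  rw [mem_interior_iff_mem_nhds, nhds_prod_eq]
  refine Filter.mem_of_superset (Filter.prod_mem_prod hQ (Ioi_mem_nhds hlev)) ?_
  rintro ⟨b', t⟩ ⟨hb', ht⟩
  refine hup b' _ t (le_of_lt ht) ?_
  have h1 : (1 - s)⁻¹ • (b' - s • b₀) ∈ {b' | (b', τ) ∈ D} := interior_subset (hPQ hs hb')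
  have h2 := hD h1 h₀ (sub_nonneg.2 hs1.le) hs0.le (sub_add_cancel 1 s)
  have hne : 1 - s ≠ 0 := (sub_pos.2 hs1).ne'
  simpa [smul_smul, hne] using h2

theorem mem_interior_dom_value_iff (hρ : ClosedProperConvex ρ) (hφ : ClosedProperConvex φ)
    {b : EuclideanSpace ℝ (Fin m)} {τ : ℝ} :
    (b, τ) ∈ interior (dom (value ρ φ A)) ↔
      (⨅ x, φ x) < (τ : EReal) ∧ b ∈ interior (dom ρ + A.toEuclideanLin '' lev φ τ) := by
  have hslice : dom ρ + A.toEuclideanLin '' lev φ τ = {b' | (b', τ) ∈ dom (value ρ φ A)} :=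
    Set.ext fun b' => (mem_dom_value_iff hρ.ne_bot).symm
  rw [hslice]
  constructor
  · intro h
    have hnhds := mem_interior_iff_mem_nhds.1 h
    constructor
    · have hτ : ∀ᶠ t in nhds τ, (b, t) ∈ dom (value ρ φ A) :=
        (Continuous.prodMk_right b).continuousAt.eventually_mem hnhds
      obtain ⟨t, ht, htτ⟩ :=
        ((hτ.filter_mono nhdsWithin_le_nhds).and (self_mem_nhdsWithin (s := Set.Iio τ))).exists
      obtain ⟨x, -, hx⟩ := (value_lt_iff hρ.ne_bot).1 ht
      exact (iInf_le _ x).trans_lt (hx.trans_lt (EReal.coe_lt_coe_iff.2 htτ))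
    · rw [mem_interior_iff_mem_nhds]
      exact (Continuous.prodMk_left τ).continuousAt.eventually_mem hnhds
  · rintro ⟨hτ, hb⟩
    obtain ⟨x₀, hx₀⟩ := iInf_lt_iff.1 hτ
    obtain ⟨τ₀, h1, h2⟩ := EReal.lt_iff_exists_real_btwn.1 hx₀
    obtain ⟨w₀, hw₀⟩ := hρ.dom_nonempty
    refine mem_interior_of_mem_interior_slice
      (convex_dom_of_strictEpigraph (convex_strictEpigraph_value hρ hφ)) ?_
      ((mem_dom_value_iff hρ.ne_bot).2 (Set.add_mem_add hw₀ ⟨x₀, h1.le, rfl⟩))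
      (EReal.coe_lt_coe_iff.1 h2) hb
    intro b' s t hst hs
    obtain ⟨x, hx1, hx2⟩ := (value_lt_iff hρ.ne_bot).1 hs
    exact (value_lt_iff hρ.ne_bot).2 ⟨x, hx1, hx2.trans (EReal.coe_le_coe_iff.2 hst)⟩

theorem subdiff_value_nonempty (hρ : ClosedProperConvex ρ) (hφ : ClosedProperConvex φ)
    {q : EuclideanSpace ℝ (Fin m) × ℝ} (hq : q ∈ interior (dom (value ρ φ A))) {a : ℝ}
    (ha : value ρ φ A q = a) : (subdiff (value ρ φ A) q).Nonempty := by
  obtain ⟨g, hg⟩ := exists_subgradient (convex_strictEpigraph_value hρ hφ) hq ha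
  refine ⟨((InnerProductSpace.toDual ℝ _).symm
    (g.comp (ContinuousLinearMap.inl ℝ (EuclideanSpace ℝ (Fin m)) ℝ)), g (0, 1)), fun q' => ?_⟩
  rw [ha, ← EReal.coe_add]
  convert hg q' using 3
  have : q' - q = (q'.1 - q.1, (0 : ℝ)) + (q'.2 - q.2) • ((0 : EuclideanSpace ℝ (Fin m)), (1 : ℝ)) := by
    ext <;> simp
  rw [this, map_add, map_smul]
  simp [mul_comm]

/-- Strong duality, attainment, and the description of the subdifferential by dual maximizers.
If `v(q) = -∞`, then the dual objective is identically `-∞` and both sets are the whole space. -/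
theorem strong_duality (hρ : ClosedProperConvex ρ) (hφ : ClosedProperConvex φ)
    {q : EuclideanSpace ℝ (Fin m) × ℝ} (hq : q ∈ interior (dom (value ρ φ A))) :
    value ρ φ A q = dualValue ρ φ A q ∧ (subdiff (value ρ φ A) q).Nonempty ∧
      subdiff (value ρ φ A) q = argmaxOn Set.univ (dualObj ρ φ A q) := by
  have hweak : dualValue ρ φ A q ≤ value ρ φ A q := iSup_le fun p => dualObj_le_value q p
  induction ha : value ρ φ A q with
  | top => exact absurd ha (ne_of_lt (show q ∈ dom _ from interior_subset hq))
  | bot =>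
    have hobj : ∀ p, dualObj ρ φ A q p = ⊥ := fun p =>
      le_bot_iff.1 ((dualObj_le_value q p).trans_eq ha)
    have hsub : subdiff (value ρ φ A) q = Set.univ :=
      Set.eq_univ_of_forall fun p q' => by simp [ha]
    refine ⟨(le_bot_iff.1 (hweak.trans_eq ha)).symm, hsub ▸ Set.univ_nonempty, ?_⟩
    rw [hsub]
    refine (Set.eq_univ_of_forall fun p => ?_).symm
    exact ⟨trivial, fun p' _ => by rw [hobj, hobj]⟩
  | coe a =>
    obtain ⟨p₀, hp₀⟩ := subdiff_value_nonempty hρ hφ hq ha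
    have h₀ := (mem_subdiff_value_iff ha p₀).1 hp₀
    refine ⟨ha ▸ le_antisymm (h₀.trans (le_iSup (dualObj ρ φ A q) p₀)) hweak, ⟨p₀, hp₀⟩, ?_⟩
    ext p
    rw [mem_subdiff_value_iff ha]
    exact ⟨fun h => ⟨trivial, fun p' _ => (dualObj_le_value q p').trans h⟩,
      fun h => h₀.trans (h.2 p₀ trivial)⟩

/-- Points with `μ > 0` have dual objective `-∞`, so they are never maximizers when the optimal
value is finite. -/
theorem argmaxOn_dualObj_nonpos (hρ : ClosedProperConvex ρ) (hφ : ClosedProperConvex φ)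
    {q : EuclideanSpace ℝ (Fin m) × ℝ} (hq : ⊥ < dualValue ρ φ A q) :
    argmaxOn Set.univ (dualObj ρ φ A q) = argmaxOn {p | p.2 ≤ 0} (dualObj ρ φ A q) := by
  have hpos : ∀ p : EuclideanSpace ℝ (Fin m) × ℝ, ¬ p.2 ≤ 0 → dualObj ρ φ A q p = ⊥ :=
    fun p hp => dualObj_of_pos hρ hφ q p.1 (not_le.1 hp)
  ext p
  constructor
  · rintro ⟨-, hp⟩
    refine ⟨?_, fun p' _ => hp p' trivial⟩
    by_contra hp'
    exact absurd hq (not_lt.2 (iSup_le fun p' => (hp p' trivial).trans_eq (hpos p hp')))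
  · rintro ⟨-, hp⟩
    refine ⟨trivial, fun p' _ => ?_⟩
    by_cases h : p'.2 ≤ 0
    · exact hp p' h
    · rw [hpos p' h]
      exact bot_le

end Problem

end ConvexValue

theorem mainTheorem2 {m n : ℕ}
    (ρ : EuclideanSpace ℝ (Fin m) → EReal) (φ : EuclideanSpace ℝ (Fin n) → EReal)
    (A : Matrix (Fin m) (Fin n) ℝ)
    (hρ : ConvexValue.ClosedProperConvex ρ) (hφ : ConvexValue.ClosedProperConvex φ)
    (b : EuclideanSpace ℝ (Fin m)) (τ : ℝ) :
    ConvexValue.dualValue ρ φ A (b, τ) ≤ ConvexValue.value ρ φ A (b, τ)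
    ∧ ((b, τ) ∈ interior (ConvexValue.dom (ConvexValue.value ρ φ A)) →
        ConvexValue.value ρ φ A (b, τ) = ConvexValue.dualValue ρ φ A (b, τ)
        ∧ (ConvexValue.subdiff (ConvexValue.value ρ φ A) (b, τ)).Nonempty
        ∧ ConvexValue.subdiff (ConvexValue.value ρ φ A) (b, τ)
            = ConvexValue.argmaxOn Set.univ (ConvexValue.dualObj ρ φ A (b, τ))
        ∧ ConvexValue.subdiff (ConvexValue.value ρ φ A) (b, τ)
            = ConvexValue.argmaxOn Set.univ (ConvexValue.explicitDualObj ρ φ A (b, τ))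
        ∧ (⊥ < ConvexValue.value ρ φ A (b, τ) →
            ConvexValue.subdiff (ConvexValue.value ρ φ A) (b, τ)
              = ConvexValue.argmaxOn {p | p.2 ≤ 0} (ConvexValue.explicitDualObj ρ φ A (b, τ))))
    ∧ ((ConvexValue.dom fun x => ConvexValue.pert ρ φ A x b τ).Nonempty ↔
        b ∈ ConvexValue.dom ρ + A.toEuclideanLin '' ConvexValue.lev φ τ)
    ∧ ((b, τ) ∈ interior (ConvexValue.dom (ConvexValue.value ρ φ A)) ↔
        (⨅ x, φ x) < (τ : EReal)
        ∧ b ∈ interior (ConvexValue.dom ρ + A.toEuclideanLin '' ConvexValue.lev φ τ)) := by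
  refine ⟨iSup_le fun p => ConvexValue.dualObj_le_value _ p, fun hq => ?_, ?_,
    ConvexValue.mem_interior_dom_value_iff hρ hφ⟩
  · obtain ⟨hval, hne, hsub⟩ := ConvexValue.strong_duality hρ hφ hq
    rw [ConvexValue.explicitDualObj_eq_dualObj hρ hφ]
    refine ⟨hval, hne, hsub, hsub, fun hbot => ?_⟩
    rw [hsub, ConvexValue.argmaxOn_dualObj_nonpos hρ hφ (hval ▸ hbot)]
  · rw [ConvexValue.dom_pert_nonempty_iff, ConvexValue.mem_dom_value_iff hρ.ne_bot]
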